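/- Let $(G,+,\le)$ be a partially ordered abelian group (that is, an abelian group with a translation-invariant partial order), with positive cone $G^+=\{a\in G : 0\le a\}$, and write $\mathbb N=\{1,2,3,\dots\}$. Assume that - $G$ is archimedean: whenever $a,b\in G$ satisfy $0\le \ell a+b$ for all $\ell\in\mathbb N$, then $0\le a$; - $G$ is directed: for every $a\in G$ there are $b,c\in G^+$ with $a=b-c$. Let $\mu\colon G\times G\to G$ be a biadditive binary operation (i.e. additive in each argument) such that $\mu(a,b)\in G^+$ for all $a,b\in G^+$, and let $\mu^+\colon G^+\times G^+\to G^+$ be its restriction to the commutative monoid $G^+$. If $G^+$ is weakly $\mu^+$-localizable, then $G^+$ is strongly $\mu^+$-localizable. Here the following terminology is used for a commutative monoid $M$ and a biadditive binary operation $\nu$ on $M$. The canonical quasi-order on $M$ is defined by $a\lesssim b$ if and only if there are $c,t\in M$ and $k\in\mathbb N$ such that $ka+c+t=kb+t$. An element $s\in M$ is left $\nu$-localizable if, whenever $a,b\in M$ satisfy $\nu(s,a)+a\lesssim\nu(s,b)+b$, then $a\lesssim b$; it is $\nu$-localizable if it is both left $\nu$-localizable and left $\nu^{\mathrm{op}}$-localizable,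 where $\nu^{\mathrm{op}}(a,b)=\nu(b,a)$. The monoid $M$ is weakly $\nu$-localizable if for every $a\in M$ there is a $\nu$-localizable $s\in M$ with $a\lesssim s$, and strongly $\nu$-localizable if every $s\in M$ is $\nu$-localizable. -/

import Mathlib

namespace Localizability

section Monoid

variable {M : Type*} [AddCommMonoid M]

/-- The canonical quasi-order `a ≲ b` on a commutative monoid. -/
def CanLE (a b : M) : Prop :=
  ∃ (c t : M) (k : ℕ), 0 < k ∧ k • a + c + t = k • b + t

/-- A binary operation that is additive in each argument. -/
structure IsBiadditive (μ : M → M → M) : Prop where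
  add_left : ∀ a a' b : M, μ (a + a') b = μ a b + μ a' b
  add_right : ∀ b a a' : M, μ b (a + a') = μ b a + μ b a'

/-- The opposite operation. -/
def opposite (μ : M → M → M) : M → M → M := fun a b => μ b a

/-- Left `μ`-localizable elements. -/
def IsLeftLocalizable (μ : M → M → M) (s : M) : Prop :=
  ∀ a b : M, CanLE (μ s a + a) (μ s b + b) → CanLE a b

/-- `μ`-localizable elements. -/
def IsLocalizable (μ : M → M → M) (s : M) : Prop :=
  IsLeftLocalizable μ s ∧ IsLeftLocalizable (opposite μ) s

/-- The commutative monoid `M` is weakly `μ`-localizable. -/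
def WeaklyLocalizable (μ : M → M → M) : Prop :=
  ∀ a : M, ∃ s : M, IsLocalizable μ s ∧ CanLE a s

/-- The commutative monoid `M` is strongly `μ`-localizable. -/
def StronglyLocalizable (μ : M → M → M) : Prop :=
  ∀ s : M, IsLocalizable μ s

end Monoid

section Group

variable (G : Type*) [AddCommGroup G] [PartialOrder G] [IsOrderedAddMonoid G]

/-- The archimedean property of a partially ordered abelian group. This is not the Mathlib class
`Archimedean`, which is a different condition when the order is not total. -/
def IsArchimedeanGroup : Prop :=
  ∀ a b : G, (∀ l : ℕ, 0 < l → 0 ≤ l • a + b) → 0 ≤ a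

/-- A partially ordered abelian group is directed if every element is a difference of two
elements of the positive cone. -/
def IsDirectedGroup : Prop :=
  ∀ a : G, ∃ b c : G, 0 ≤ b ∧ 0 ≤ c ∧ a = b - c

variable {G}

/-- The restriction `μ⁺` of a positivity-preserving binary operation to the positive cone `G⁺`. -/
def restrictNonneg (μ : G → G → G) (hμ : ∀ a b : G, 0 ≤ a → 0 ≤ b → 0 ≤ μ a b) :
    AddSubmonoid.nonneg G → AddSubmonoid.nonneg G → AddSubmonoid.nonneg G :=
  fun a b => ⟨μ a b, hμ a b a.2 b.2⟩

/-- The restriction of a biadditive operation is a biadditive operation on the monoid `G⁺`. -/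
theorem IsBiadditive.restrictNonneg {μ : G → G → G} (h : IsBiadditive μ)
    (hμ : ∀ a b : G, 0 ≤ a → 0 ≤ b → 0 ≤ μ a b) :
    IsBiadditive (restrictNonneg μ hμ) where
  add_left a a' b := Subtype.ext (h.add_left a a' b)
  add_right b a a' := Subtype.ext (h.add_right b a a')

end Group

end Localizability

/-!
A directed archimedean group is unperforated, so `≲` on `G⁺` is the order of `G`, and `s` is left
localizable exactly when `x ↦ x + μ s x` is inverse-positive. Since `G⁺` is weakly localizable, it
suffices to show: if `S` and `P` are positive additive maps, the range of `S` is cofinal, and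
`S + P` is inverse-positive, then so is `S`. Here `S x = x + μ s x` and `P x = μ t x`, with `s + t`
localizable.

Formally, `(m + 1) S + P = (m + 1) (S + P) - m P` is inverted by a Neumann series in
`(m / (m + 1)) (S + P)⁻¹ P`, whose terms are positive and whose convergence is supplied by the
archimedean property. Letting `m → ∞` and using the archimedean property again gives the claim
for `S`.
-/

namespace Localizability

theorem exists_mul_pow_lt_pow {m n : ℕ} (hmn : m < n) (l : ℕ) : ∃ j : ℕ, l * m ^ j < n ^ j := by
  have hn : (0 : ℚ) < n := by exact_mod_cast hmn.pos
  have hl : (0 : ℚ) < l + 1 := by positivity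
  obtain ⟨j, hj⟩ := exists_pow_lt_of_lt_one (inv_pos.2 hl)
    ((div_lt_one hn).2 (Nat.cast_lt.2 hmn))
  refine ⟨j, ?_⟩
  rw [div_pow, div_lt_iff₀ (pow_pos hn j), lt_inv_mul_iff₀ hl] at hj
  have hj' : (l + 1) * m ^ j < n ^ j := by exact_mod_cast hj
  exact (Nat.mul_le_mul_right _ l.le_succ).trans_lt hj'

/-- A map is inverse-positive if it sends only nonnegative elements to nonnegative elements. For
an additive map this says that it reflects the order; it need be neither positive nor bijective. -/
def IsInversePositive {G H : Type*} [Zero G] [LE G] [Zero H] [LE H] (T : G → H) : Prop :=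
  ∀ ⦃x : G⦄, 0 ≤ T x → 0 ≤ x

section OrderedGroup

variable {G H : Type*} [AddCommGroup G] [PartialOrder G]
  [AddCommGroup H] [PartialOrder H] [IsOrderedAddMonoid H] {S P : G →+o H}

/-- The remainder of the Neumann series: formally, `-(m / (m + 1)) ^ j • a ≤ x`. -/
theorem IsInversePositive.pow_nsmul_add_pow_nsmul_nonneg (hSP : IsInversePositive (S + P))
    {m : ℕ} {x a : G} (hx : 0 ≤ (m + 1) • S x + P x) (ha : 0 ≤ a) (hxa : 0 ≤ x + a) (j : ℕ) :
    0 ≤ (m + 1) ^ j • x + m ^ j • a := by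
  induction j with
  | zero => simpa using hxa
  | succ j ih =>
    apply hSP
    calc
      0 ≤ (m + 1) ^ j • ((m + 1) • S x + P x) + m • P ((m + 1) ^ j • x + m ^ j • a)
          + m ^ (j + 1) • S a :=
        add_nonneg (add_nonneg (nsmul_nonneg hx _) (nsmul_nonneg (map_nonneg P ih) m))
          (nsmul_nonneg (map_nonneg S ha) _)
      _ = (S + P) ((m + 1) ^ (j + 1) • x + m ^ (j + 1) • a) := by
        simp only [OrderAddMonoidHom.add_apply, map_add, map_nsmul]
        module

variable [IsOrderedAddMonoid G]

theorem IsDirectedGroup.exists_nonneg_ge (hDir : IsDirectedGroup G) (x : G) :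
    ∃ a, 0 ≤ a ∧ x ≤ a := by
  obtain ⟨a, b, ha, hb, rfl⟩ := hDir x
  exact ⟨a, ha, sub_le_self a hb⟩

theorem IsArchimedeanGroup.nonneg_of_nsmul_nonneg (hArch : IsArchimedeanGroup G)
    (hDir : IsDirectedGroup G) {k : ℕ} (hk : 0 < k) {x : G} (hx : 0 ≤ k • x) : 0 ≤ x := by
  obtain ⟨a, ha, hxa⟩ := hDir.exists_nonneg_ge (-x)
  rw [neg_le_iff_add_nonneg'] at hxa
  refine hArch x (k • a) fun l _ => ?_
  obtain ⟨d, hd⟩ := Nat.exists_eq_add_of_le (Nat.mod_lt l hk).le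
  have hsplit : l • x + k • a = (l / k) • k • x + (l % k) • (x + a) + d • a := by
    have hk' : k • a = (l % k) • a + d • a := by rw [← add_nsmul, ← hd]
    nth_rw 1 [← Nat.div_add_mod' l k]
    rw [hk']
    module
  rw [hsplit]
  exact add_nonneg (add_nonneg (nsmul_nonneg hx _) (nsmul_nonneg hxa _)) (nsmul_nonneg ha d)

theorem IsArchimedeanGroup.posSMulReflectLE_nat (hArch : IsArchimedeanGroup G)
    (hDir : IsDirectedGroup G) : PosSMulReflectLE ℕ G where
  le_of_smul_le_smul_left k hk x y hxy :=
    sub_nonneg.1 <| hArch.nonneg_of_nsmul_nonneg hDir hk <| by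
      rw [smul_sub]
      exact sub_nonneg.2 hxy

theorem IsArchimedeanGroup.nonneg_of_forall_pow_nsmul_add_pow_nsmul_nonneg
    [PosSMulReflectLE ℕ G] (hArch : IsArchimedeanGroup G) {m n : ℕ} (hmn : m < n) {x a : G}
    (ha : 0 ≤ a) (h : ∀ j : ℕ, 0 ≤ n ^ j • x + m ^ j • a) : 0 ≤ x := by
  refine hArch x a fun l _ => ?_
  obtain ⟨j, hj⟩ := exists_mul_pow_lt_pow hmn l
  have hscaled : 0 ≤ n ^ j • (l • x + a) :=
    calc
      0 ≤ l • (n ^ j • x + m ^ j • a) := nsmul_nonneg (h j) l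
      _ = n ^ j • l • x + (l * m ^ j) • a := by module
      _ ≤ n ^ j • l • x + n ^ j • a := by gcongr
      _ = n ^ j • (l • x + a) := (smul_add _ _ _).symm
  exact nonneg_of_smul_nonneg_of_pos_left hscaled (pow_pos hmn.pos j)

theorem IsInversePositive.succ_nsmul_add (hArch : IsArchimedeanGroup G) (hDir : IsDirectedGroup G)
    (hSP : IsInversePositive (S + P)) (m : ℕ) : IsInversePositive ((m + 1) • ⇑S + ⇑P) := by
  intro x hx
  have := hArch.posSMulReflectLE_nat hDir
  obtain ⟨a, ha, hxa⟩ := hDir.exists_nonneg_ge (-x)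
  rw [neg_le_iff_add_nonneg'] at hxa
  exact hArch.nonneg_of_forall_pow_nsmul_add_pow_nsmul_nonneg m.lt_succ_self ha
    (hSP.pow_nsmul_add_pow_nsmul_nonneg hx ha hxa)

theorem IsInversePositive.of_add_right (hArch : IsArchimedeanGroup G) (hDir : IsDirectedGroup G)
    (hS : IsCofinal (Set.range S)) (hSP : IsInversePositive (S + P)) : IsInversePositive S := by
  intro x hx
  obtain ⟨a, -, hxa⟩ := hDir.exists_nonneg_ge (-x)
  rw [neg_le_iff_add_nonneg'] at hxa
  obtain ⟨_, ⟨y, rfl⟩, hy⟩ := hS (P a)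
  obtain ⟨z, hz, hyz⟩ := hDir.exists_nonneg_ge y
  have hPS : 0 ≤ S z - P a := sub_nonneg.2 (hy.trans (S.monotone' hyz))
  refine hArch x z fun l hl => ?_
  obtain ⟨m, rfl⟩ := Nat.exists_eq_add_one.2 hl
  apply hSP.succ_nsmul_add hArch hDir m
  calc
    0 ≤ (m + 1) ^ 2 • S x + (m + 1) • P (x + a) + (m + 1) • (S z - P a) + P z :=
      add_nonneg (add_nonneg (add_nonneg (nsmul_nonneg hx _)
        (nsmul_nonneg (map_nonneg P hxa) _)) (nsmul_nonneg hPS _)) (map_nonneg P hz)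
    _ = ((m + 1) • ⇑S + ⇑P) ((m + 1) • x + z) := by
      simp only [Pi.add_apply, Pi.smul_apply, map_add, map_nsmul]
      module

theorem canLE_nonneg_iff_le [PosSMulReflectLE ℕ G] {a b : AddSubmonoid.nonneg G} :
    CanLE a b ↔ a ≤ b := by
  constructor
  · rintro ⟨c, t, k, hk, h⟩
    have hkc : k • a + c = k • b := add_right_cancel h
    have hle : k • (a : G) ≤ k • (b : G) :=
      calc
        k • (a : G) ≤ k • (a : G) + c := le_add_of_nonneg_right c.2
        _ = k • (b : G) := congrArg Subtype.val hkc
    exact Subtype.coe_le_coe.1 (le_of_smul_le_smul_left hle hk)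
  · intro h
    exact ⟨⟨b - a, sub_nonneg.2 h⟩, 0, 1, one_pos, Subtype.ext (by simp)⟩

end OrderedGroup

section Biadditive

theorem IsBiadditive.opposite {M : Type*} [AddCommMonoid M] {μ : M → M → M}
    (hbi : IsBiadditive μ) : IsBiadditive (opposite μ) where
  add_left a a' b := hbi.add_right b a a'
  add_right b a a' := hbi.add_left a a' b

variable {G : Type*} [AddCommGroup G] [PartialOrder G] [IsOrderedAddMonoid G] {μ : G → G → G}

/-- Left multiplication `x ↦ μ s x` by an element `s` of the positive cone, as a positive
endomorphism of `G`. -/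
def IsBiadditive.mulLeft (hbi : IsBiadditive μ) (hμ : ∀ a b : G, 0 ≤ a → 0 ≤ b → 0 ≤ μ a b)
    (s : AddSubmonoid.nonneg G) : G →+o G where
  toAddMonoidHom := AddMonoidHom.mk' (μ s) (hbi.add_right s)
  monotone' := (monotone_iff_map_nonneg (AddMonoidHom.mk' (μ s) (hbi.add_right s))).2
    fun x hx => hμ s x s.2 hx

theorem isLeftLocalizable_restrictNonneg_iff [PosSMulReflectLE ℕ G] (hDir : IsDirectedGroup G)
    (hbi : IsBiadditive μ) (hμ : ∀ a b : G, 0 ≤ a → 0 ≤ b → 0 ≤ μ a b)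
    {s : AddSubmonoid.nonneg G} :
    IsLeftLocalizable (restrictNonneg μ hμ) s ↔
      IsInversePositive (.id G + hbi.mulLeft hμ s : G →+o G) := by
  set T : G →+o G := .id G + hbi.mulLeft hμ s
  have hT (a b : AddSubmonoid.nonneg G) :
      restrictNonneg μ hμ s a + a ≤ restrictNonneg μ hμ s b + b ↔ 0 ≤ T (b - a) := by
    rw [map_sub, sub_nonneg, ← Subtype.coe_le_coe]
    change μ s a + a ≤ μ s b + b ↔ a + μ s a ≤ b + μ s b
    rw [add_comm, add_comm (μ s b)]
  simp only [IsLeftLocalizable, canLE_nonneg_iff_le, hT]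
  constructor
  · intro h x hx
    obtain ⟨b, a, hb, ha, rfl⟩ := hDir x
    exact sub_nonneg.2 (h ⟨a, ha⟩ ⟨b, hb⟩ hx)
  · intro h a b hab
    exact Subtype.coe_le_coe.1 (sub_nonneg.1 (h hab))

theorem IsLeftLocalizable.of_le (hArch : IsArchimedeanGroup G) (hDir : IsDirectedGroup G)
    (hbi : IsBiadditive μ) {hμ : ∀ a b : G, 0 ≤ a → 0 ≤ b → 0 ≤ μ a b}
    {s s' : AddSubmonoid.nonneg G} (hs' : IsLeftLocalizable (restrictNonneg μ hμ) s')
    (hss' : s ≤ s') : IsLeftLocalizable (restrictNonneg μ hμ) s := by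
  have := hArch.posSMulReflectLE_nat hDir
  obtain ⟨t, rfl⟩ : ∃ t, s' = s + t :=
    ⟨⟨s' - s, sub_nonneg.2 hss'⟩, Subtype.ext (add_sub_cancel (s : G) s').symm⟩
  rw [isLeftLocalizable_restrictNonneg_iff hDir hbi] at hs' ⊢
  have hcofinal : IsCofinal (Set.range (.id G + hbi.mulLeft hμ s : G →+o G)) := by
    intro y
    obtain ⟨x, hx, hyx⟩ := hDir.exists_nonneg_ge y
    exact ⟨_, ⟨x, rfl⟩, hyx.trans (le_add_of_nonneg_right (hμ s x s.2 hx))⟩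
  refine .of_add_right (P := hbi.mulLeft hμ t) hArch hDir hcofinal fun x hx => hs' ?_
  calc
    0 ≤ x + μ s x + μ t x := hx
    _ = x + μ (s + t) x := by rw [hbi.add_left, add_assoc]

end Biadditive

end Localizability

theorem mainTheorem7 {G : Type*} [AddCommGroup G] [PartialOrder G] [IsOrderedAddMonoid G]
    (hArch : Localizability.IsArchimedeanGroup G) (hDir : Localizability.IsDirectedGroup G)
    (μ : G → G → G) (hbi : Localizability.IsBiadditive μ)
    (hμ : ∀ a b : G, 0 ≤ a → 0 ≤ b → 0 ≤ μ a b)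
    (hweak : Localizability.WeaklyLocalizable (Localizability.restrictNonneg μ hμ)) :
    Localizability.StronglyLocalizable (Localizability.restrictNonneg μ hμ) := by
  intro s
  obtain ⟨s', ⟨hleft, hright⟩, hss'⟩ := hweak s
  have := hArch.posSMulReflectLE_nat hDir
  have hle : s ≤ s' := Localizability.canLE_nonneg_iff_le.1 hss'
  have hμop (a b : G) (ha : 0 ≤ a) (hb : 0 ≤ b) : 0 ≤ Localizability.opposite μ a b :=
    hμ b a hb ha
  exact ⟨.of_le hArch hDir hbi hleft hle,
    .of_le (hμ := hμop) hArch hDir hbi.opposite hright hle⟩
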